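/- **Conventions.** Let $x=(x_i)_{i\ge 1}$ and $b=(b_i)_{i\ge 1}$ be infinite sequences of variables, $\beta$ a formal variable, and $u\oplus v=u+v+\beta uv$. A *flagged partition* $(\lambda,f)$ of length $r\ge 0$ consists of positive integers $\lambda_1\ge\cdots\ge\lambda_r$ and positive integers $f_1\le\cdots\le f_r$; let $|\lambda|=\lambda_1+\cdots+\lambda_r$. A *flagged set-valued tableau* $T$ of $(\lambda,f)$ assigns to each box $(i,j)$, $1\le i\le r$, $1\le j\le\lambda_i$, of the Young diagram of $\lambda$ a nonempty finite subset $T_{i,j}\subseteq\{1,\dots,f_i\}$ such that $\max T_{i,j}\le\min T_{i,j+1}$ and $\max T_{i,j}<\min T_{i+1,j}$ whenever both boxes are in the diagram. An *entry* $e$ of $T$ is an element of one of these sets; $\mathrm{val}(e)$, $r(e)$, $c(e)$ denote its numeric value and the row and column index of its box, and $|T|$ is the total number of entries. Let $\mathcal T(\lambda,f)$ be the set of all such tableaux. The *factorial flagged Grothendieck polynomial* is $$G_{\lambda,f}(x|b)=\sum_{T\in\mathcal T(\lambda,f)}\beta^{|T|-|\lambda|}\prod_{e\in T}\bigl(x_{\mathrm{val}(e)}\oplus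 b_{\mathrm{val}(e)-r(e)+c(e)}\bigr)\in\mathbb Z[\beta][x,b].$$ For $m\in\mathbb Z$, $p\in\mathbb Z_{\ge0}$ and $q\in\mathbb Z$, define $\mathcal G^{[p,q]}_m\in\mathbb Z[\beta][[x,b]]$ by $$\sum_{m\in\mathbb Z}\mathcal G^{[p,q]}_m u^m=\frac1{1+\beta u^{-1}}\prod_{1\le i\le p}\frac{1+\beta x_i}{1-x_iu}\prod_{1\le i\le q}\bigl(1+(u+\beta)b_i\bigr),$$ where $\frac1{1+\beta u^{-1}}=\sum_{k\ge0}(-\beta)^ku^{-k}$ and $\frac1{1-x_iu}=\sum_{k\ge0}x_i^ku^k$, and products over an empty range (in particular the last one when $q\le0$) are $1$. For $n\in\mathbb Z$ let $\binom ns=\frac{n(n-1)\cdots(n-s+1)}{s!}$. Infinite sums in $\mathbb Z[\beta][[x,b]]$ converge coefficientwise, that is, the coefficient in $\mathbb Z[\beta]$ of each monomial in $x$ and $b$ is nonzero in only finitely many summands. **Theorem.** For every flagged partition $(\lambda,f)$ of length $r$, all the sums over $s$ below converge in $\mathbb Z[\beta][[x,b]]$, and $$G_{\lambda,f}(x|b)=\det\left(\sum_{s=0}^{\infty}\binom{i-j}{s}\beta^s\,\mathcal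 G^{[f_i,\,f_i+\lambda_i-i]}_{\lambda_i-i+j+s}\right)_{1\le i,j\le r}.$$ -/

import Mathlib

open scoped MvPowerSeries.WithPiTopology

namespace FlaggedGrothendieck

noncomputable section

/-! ### Flagged partitions and flagged set-valued tableaux -/

/-- A flagged partition of length `r`: a weakly decreasing sequence `lam` of positive integers
together with a weakly increasing sequence `f` of positive integers, both of length `r`.
The (1-based) part `λ_{i+1}` is `lam i` and the flag `f_{i+1}` is `f i`. -/
structure IsFlaggedPartition {r : ℕ} (lam f : Fin r → ℕ) : Prop where
  lam_pos : ∀ i, 0 < lam i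
  lam_anti : Antitone lam
  f_pos : ∀ i, 0 < f i
  f_mono : Monotone f

/-- The boxes of the Young diagram of `lam`; `⟨i, j⟩` is the box in row `i + 1`, column `j + 1`. -/
abbrev Box {r : ℕ} (lam : Fin r → ℕ) : Type := Σ i : Fin r, Fin (lam i)

/-- The (1-based) row index of a box. -/
def Box.row {r : ℕ} {lam : Fin r → ℕ} (c : Box lam) : ℕ := (c.1 : ℕ) + 1

/-- The (1-based) column index of a box. -/
def Box.col {r : ℕ} {lam : Fin r → ℕ} (c : Box lam) : ℕ := (c.2 : ℕ) + 1

/-- `T` is a flagged set-valued tableau of `(lam, f)`: every box carries a nonempty finite set of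
positive integers, those in row `i` being at most `f i`; for horizontally adjacent boxes
`max A ≤ min B`, and for vertically adjacent boxes `max A < min B`. -/
structure IsTableau {r : ℕ} (lam f : Fin r → ℕ) (T : Box lam → Finset ℕ) : Prop where
  nonempty : ∀ c, (T c).Nonempty
  flag : ∀ c, T c ⊆ Finset.Icc 1 (f c.1)
  row_weak : ∀ c d : Box lam, d.row = c.row → d.col = c.col + 1 →
    ∀ u ∈ T c, ∀ v ∈ T d, u ≤ v
  col_strict : ∀ c d : Box lam, d.row = c.row + 1 → d.col = c.col →
    ∀ u ∈ T c, ∀ v ∈ T d, u < v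

open Classical in
/-- The finite set of all flagged set-valued tableaux of `(lam, f)`. -/
def tableaux {r : ℕ} (lam f : Fin r → ℕ) : Finset (Box lam → Finset ℕ) :=
  (Fintype.piFinset fun c : Box lam => (Finset.Icc 1 (f c.1)).powerset).filter
    (IsTableau lam f)

theorem mem_tableaux {r : ℕ} {lam f : Fin r → ℕ} {T : Box lam → Finset ℕ} :
    T ∈ tableaux lam f ↔ IsTableau lam f T := by
  classical
  simp only [tableaux, Finset.mem_filter, Fintype.mem_piFinset, Finset.mem_powerset,
    and_iff_right_iff_imp]
  exact fun h => h.flag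

/-- Every entry is at least its row index, so that the subtraction in `val(e) - r(e) + c(e)` is
never truncated when the row index is subtracted last. -/
theorem IsTableau.row_le {r : ℕ} {lam f : Fin r → ℕ} (hlam : Antitone lam)
    {T : Box lam → Finset ℕ} (hT : IsTableau lam f T) (c : Box lam) (v : ℕ) (hv : v ∈ T c) :
    c.row ≤ v := by
  obtain ⟨⟨i, hi⟩, j⟩ := c
  induction i generalizing v with
  | zero => exact (Finset.mem_Icc.1 (hT.flag _ hv)).1
  | succ i ih =>
    have hi' : i < r := by omega
    have hj : (j : ℕ) < lam ⟨i, hi'⟩ :=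
      lt_of_lt_of_le j.2 (hlam (by simp [Fin.le_def]))
    obtain ⟨u, hu⟩ := hT.nonempty ⟨⟨i, hi'⟩, ⟨j, hj⟩⟩
    have h1 := ih u hi' ⟨j, hj⟩ hu
    have h2 := hT.col_strict ⟨⟨i, hi'⟩, ⟨j, hj⟩⟩ ⟨⟨i + 1, hi⟩, j⟩ rfl rfl u hu v hv
    simp only [Box.row] at h1 ⊢
    omega

/-! ### The factorial flagged Grothendieck polynomial -/

/-- The index type of the variables: `Sum.inl i` is `x_i` and `Sum.inr i` is `b_i`. Only the
variables with `i ≥ 1` ever occur. -/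
abbrev Var : Type := ℕ ⊕ ℕ

/-- The polynomial ring `ℤ[β][x, b]`. -/
abbrev Poly : Type := MvPolynomial Var (Polynomial ℤ)

/-- The formal variable `β` as a polynomial. -/
def betaP : Poly := MvPolynomial.C Polynomial.X

/-- `x_u ⊕ b_v = x_u + b_v + β x_u b_v`. -/
def xOplusB (u v : ℕ) : Poly :=
  MvPolynomial.X (Sum.inl u) + MvPolynomial.X (Sum.inr v)
    + betaP * MvPolynomial.X (Sum.inl u) * MvPolynomial.X (Sum.inr v)

/-- The total number of entries of `T`. -/
def entryCount {r : ℕ} {lam : Fin r → ℕ} (T : Box lam → Finset ℕ) : ℕ := ∑ c, (T c).card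

/-- The product over all entries `e` of `T` of `x_{val(e)} ⊕ b_{val(e) - r(e) + c(e)}`. -/
def weight {r : ℕ} {lam : Fin r → ℕ} (T : Box lam → Finset ℕ) : Poly :=
  ∏ c, ∏ v ∈ T c, xOplusB v (v + c.col - c.row)

/-- The factorial flagged Grothendieck polynomial `G_{λ,f}(x|b)`. -/
def G {r : ℕ} (lam f : Fin r → ℕ) : Poly :=
  ∑ T ∈ tableaux lam f, betaP ^ (entryCount T - ∑ i, lam i) * weight T

/-! ### The series `𝒢_m^{[p,q]}` -/

/-- The coefficient ring `ℤ[β]` is discrete; infinite sums of formal power series converge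
coefficientwise. -/
instance : TopologicalSpace (Polynomial ℤ) := ⊥

instance : DiscreteTopology (Polynomial ℤ) := ⟨rfl⟩

/-- The ring `ℤ[β][[x, b]]` of formal power series. -/
abbrev Ser : Type := MvPowerSeries Var (Polynomial ℤ)

/-- The formal variable `β` as a power series. -/
def beta : Ser := MvPowerSeries.C Polynomial.X

/-- The variable `x_i`. -/
def x (i : ℕ) : Ser := MvPowerSeries.X (Sum.inl i)

/-- The variable `b_i`. -/
def b (i : ℕ) : Ser := MvPowerSeries.X (Sum.inr i)

/-- The geometric series `1 / (1 - x_i u)` as a power series in `u`. -/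
def geom (i : ℕ) : PowerSeries Ser := PowerSeries.mk fun n => x i ^ n

theorem one_sub_mul_geom (i : ℕ) :
    (1 - PowerSeries.C (x i) * PowerSeries.X) * geom i = 1 := by
  ext1 n
  rw [sub_mul, one_mul, mul_assoc, map_sub, PowerSeries.coeff_C_mul]
  cases n with
  | zero => simp [geom]
  | succ n =>
    simp [geom, PowerSeries.coeff_succ_X_mul, pow_succ', PowerSeries.coeff_one]

/-- `∏_{1 ≤ i ≤ p} (1 + β x_i) / (1 - x_i u) · ∏_{1 ≤ i ≤ q} (1 + (u + β) b_i)`, as a power series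
in `u` over `ℤ[β][[x, b]]`. -/
def genProd (p q : ℕ) : PowerSeries Ser :=
  (∏ i ∈ Finset.Icc 1 p, PowerSeries.C (1 + beta * x i) * geom i) *
    ∏ i ∈ Finset.Icc 1 q, (1 + (PowerSeries.X + PowerSeries.C beta) * PowerSeries.C (b i))

/-- The coefficient of `u ^ n` in a power series in `u`, for an arbitrary integer `n`. -/
def uCoeff (n : ℤ) (P : PowerSeries Ser) : Ser :=
  if 0 ≤ n then PowerSeries.coeff n.toNat P else 0

/-- `𝒢_m^{[p,q]}`: the coefficient of `u ^ m` in the two-sided series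
`(1 + β u⁻¹)⁻¹ · genProd p q`, where `(1 + β u⁻¹)⁻¹ = ∑_{k ≥ 0} (-β) ^ k u ^ (-k)`. -/
def calG (m : ℤ) (p q : ℕ) : Ser :=
  ∑' k : ℕ, (-beta) ^ k * uCoeff (m + k) (genProd p q)

/-- The coefficient of `u ^ n` has order at least `n` in `x` and `b`, for every `n`. -/
def OrderGe (P : PowerSeries Ser) : Prop := ∀ n : ℕ, (n : ℕ∞) ≤ (PowerSeries.coeff n P).order

theorem OrderGe.mul {P Q : PowerSeries Ser} (hP : OrderGe P) (hQ : OrderGe Q) :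
    OrderGe (P * Q) := by
  intro n
  rw [PowerSeries.coeff_mul]
  refine MvPowerSeries.le_order fun d hd => ?_
  rw [map_sum]
  refine Finset.sum_eq_zero fun k hk => MvPowerSeries.coeff_of_lt_order ?_
  refine lt_of_lt_of_le hd (le_trans ?_ MvPowerSeries.le_order_mul)
  rw [← Finset.HasAntidiagonal.mem_antidiagonal.1 hk]
  push_cast
  exact add_le_add (hP _) (hQ _)

theorem OrderGe.add {P Q : PowerSeries Ser} (hP : OrderGe P) (hQ : OrderGe Q) :
    OrderGe (P + Q) := by
  intro n
  rw [map_add]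
  exact le_trans (le_min (hP n) (hQ n)) MvPowerSeries.min_order_le_add

theorem orderGe_C (a : Ser) : OrderGe (PowerSeries.C a) := by
  intro n
  rw [PowerSeries.coeff_C]
  split_ifs with h
  · simp [h]
  · simp

theorem orderGe_one : OrderGe 1 := by
  simpa using orderGe_C 1

theorem orderGe_prod (s : Finset ℕ) (F : ℕ → PowerSeries Ser) (h : ∀ i ∈ s, OrderGe (F i)) :
    OrderGe (∏ i ∈ s, F i) :=
  Finset.prod_induction F OrderGe (fun _ _ => OrderGe.mul) orderGe_one h

theorem orderGe_geom (i : ℕ) : OrderGe (geom i) := by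
  intro n
  rw [geom, PowerSeries.coeff_mk]
  exact MvPowerSeries.le_order_pow_of_constantCoeff_eq_zero n (by simp [x])

theorem orderGe_X_mul_b (i : ℕ) : OrderGe (PowerSeries.X * PowerSeries.C (b i)) := by
  intro n
  rcases n with _ | n
  · simp
  · rw [PowerSeries.coeff_succ_X_mul, PowerSeries.coeff_C]
    split_ifs with h
    · subst h
      simpa [MvPowerSeries.one_le_order_iff_constCoeff_eq_zero] using by simp [b]
    · simp

theorem orderGe_genProd (p q : ℕ) : OrderGe (genProd p q) := by
  refine OrderGe.mul (orderGe_prod _ _ fun i _ => (orderGe_C _).mul (orderGe_geom i))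
    (orderGe_prod _ _ fun i _ => orderGe_one.add ?_)
  rw [add_mul]
  exact (orderGe_X_mul_b i).add ((orderGe_C _).mul (orderGe_C _))

/-- The infinite sum that defines `𝒢_m^{[p,q]}` converges. -/
theorem summable_calG (m : ℤ) (p q : ℕ) :
    Summable fun k : ℕ => (-beta) ^ k * uCoeff (m + k) (genProd p q) := by
  rw [MvPowerSeries.WithPiTopology.summable_iff_summable_coeff]
  intro d
  refine summable_of_hasFiniteSupport
    ((Set.finite_Iic ((d.degree : ℤ) - m).toNat).subset fun k hk => ?_)
  by_contra hlt
  rw [Set.mem_Iic, not_le] at hlt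
  refine hk (MvPowerSeries.coeff_of_lt_order
    (lt_of_lt_of_le ?_ (le_trans le_add_self MvPowerSeries.le_order_mul)))
  have h0 : 0 ≤ m + k := by omega
  rw [uCoeff, if_pos h0]
  refine lt_of_lt_of_le ?_ (orderGe_genProd p q _)
  have h1 : d.degree < (m + k).toNat := by omega
  exact_mod_cast h1

/-- The generating function `(1 + β u⁻¹) · ∑_m 𝒢_m^{[p,q]} u ^ m = genProd p q`, compared at
`u ^ m`. -/
theorem calG_add_beta_mul (m : ℤ) (p q : ℕ) :
    calG m p q + beta * calG (m + 1) p q = uCoeff m (genProd p q) := by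
  have h := (summable_calG m p q).tsum_eq_zero_add
  have h2 : ∀ k : ℕ, (-beta) ^ (k + 1) * uCoeff (m + ((k + 1 : ℕ) : ℤ)) (genProd p q)
      = (-beta) * ((-beta) ^ k * uCoeff (m + 1 + k) (genProd p q)) := by
    intro k
    have h3 : m + ((k + 1 : ℕ) : ℤ) = m + 1 + k := by push_cast; ring
    rw [h3, pow_succ', mul_assoc]
  simp only [h2] at h
  rw [(summable_calG (m + 1) p q).tsum_mul_left] at h
  simp only [calG]
  rw [h]
  simp

/-! ### The determinant -/

/-- The `s`-th summand `C(i-j, s) β^s 𝒢_{λ_i - i + j + s}^{[f_i, f_i + λ_i - i]}` of the `(i, j)`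
entry of the determinant, with a generalized binomial coefficient. As `i` and `j` are 0-based here,
`i` stands for the row `i + 1`. A negative upper bound `f_i + λ_i - i` gives an empty product,
exactly as the bound `0` does. -/
def entryTerm {r : ℕ} (lam f : Fin r → ℕ) (i j : Fin r) (s : ℕ) : Ser :=
  ((Ring.choose ((i : ℤ) - (j : ℤ)) s : ℤ) : Ser) * beta ^ s *
    calG ((lam i : ℤ) - (i : ℤ) + (j : ℤ) + (s : ℤ)) (f i)
      ((f i : ℤ) + (lam i : ℤ) - ((i : ℤ) + 1)).toNat

end

end FlaggedGrothendieck

/-!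
Both sides of the formula satisfy the same recursion, for weakly decreasing `λ` and weakly increasing
`f` that may contain zeros. Let `k` be the first row whose flag is the largest one, `f_k = n + 1`.

If row `k` is longer than the next row, then `n + 1` occurs in row `k` if and only if it occurs in
the last box of the row. Its absence there, its presence with other entries, and its presence alone
give (`tableauSum_last_box`)
`G_{λ,f} = (1 + β (x ⊕ b)) G_{λ,f'} + (x ⊕ b) G_{λ',f}`,
where `f'` lowers `f_k` to `n` and `λ'` removes the last box. Otherwise row `k` is empty, or the next
row has the same length and flag and `n + 1` cannot occur in row `k`, so that `G_{λ,f} = G_{λ,f'}`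
(`tableauSum_update_flag`).

For the determinant, put `w = u + β` and `y = x / (1 + β x)`. The entry in row `i` and column `j` is
the coefficient of `u ^ λ_i` in
`w ^ (i - j) (1 + β u⁻¹)⁻¹ ∏_{l ≤ f_i} (1 - y_l w)⁻¹ ∏_{l ≤ f_i + λ_i - i} (1 + b_l w)`,
because `(1 + β x) / (1 - x u) = 1 / (1 - y w)`. Hence each linear relation between the polynomials
`1`, `u`, `w` yields a relation between entries that is uniform in `j`, that is, between rows. The
relation `1 + b w = (1 + β b) (1 - x u) + (x ⊕ b) u` gives the first recursion by linearity of the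
determinant in row `k` (`entrySum_box`, `det_entryMatrix_last_box`). The relation
`(1 + b w) - (b + y) w = 1 - y w` shows that, for two consecutive rows of the same length and flag,
lowering the upper flag subtracts a multiple of the lower row (`exists_entrySum_flag`,
`det_entryMatrix_update_flag`). The recursion ends at the empty partition, where the matrix is upper
unitriangular, or at `f = 0`, where the first row of the matrix vanishes and there are no tableaux.

The factors `1 + b_l w` exist for `l ≥ 1` only, although `f_i + λ_i - i` may be negative. Setting
`b_l = 0` for `l ≤ 0` (`bInt`) makes the relations between entries hold for all integral bounds.
-/

namespace FlaggedGrothendieck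

noncomputable section

/-! ### Two-sided series acted on by series in `β u⁻¹` -/

/-- A sequence of power series in `x` and `b`, indexed by the exponents of `u`, that tends to zero
coefficientwise as the exponent tends to `+∞`. -/
def EventuallyZero (g : ℤ → Ser) : Prop :=
  ∀ d : Var →₀ ℕ, ∃ M : ℤ, ∀ m ≥ M, MvPowerSeries.coeff d (g m) = 0

/-- The coefficient of `u ^ m` in `(∑ s, c s * β ^ s * u ^ (-s)) * (∑ m, g m * u ^ m)`. -/
def betaSum (c : ℕ → ℤ) (g : ℤ → Ser) (m : ℤ) : Ser :=
  ∑' s : ℕ, (c s : Ser) * beta ^ s * g (m + s)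

theorem coeff_intCast_mul_beta_pow_mul (d : Var →₀ ℕ) (a : ℤ) (s : ℕ) (y : Ser) :
    MvPowerSeries.coeff d ((a : Ser) * beta ^ s * y) =
      (a : Polynomial ℤ) * Polynomial.X ^ s * MvPowerSeries.coeff d y := by
  have h : (a : Ser) * beta ^ s =
      MvPowerSeries.C ((a : Polynomial ℤ) * Polynomial.X ^ s) := by
    simp [beta]
  rw [h, MvPowerSeries.coeff_C_mul]

theorem EventuallyZero.summable {g : ℤ → Ser} (hg : EventuallyZero g) (c : ℕ → ℤ) (m : ℤ) :
    Summable fun s : ℕ => (c s : Ser) * beta ^ s * g (m + s) := by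
  rw [MvPowerSeries.WithPiTopology.summable_iff_summable_coeff]
  intro d
  obtain ⟨M, hM⟩ := hg d
  refine summable_of_hasFiniteSupport ((Set.finite_Iic (M - m).toNat).subset fun k hk => ?_)
  by_contra hlt
  rw [Set.mem_Iic, not_le] at hlt
  refine hk ?_
  beta_reduce
  rw [coeff_intCast_mul_beta_pow_mul, hM _ (by omega), mul_zero]

theorem EventuallyZero.betaSum {g : ℤ → Ser} (hg : EventuallyZero g) (c : ℕ → ℤ) :
    EventuallyZero (betaSum c g) := by
  intro d
  obtain ⟨M, hM⟩ := hg d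
  refine ⟨M, fun m hm => ?_⟩
  have h := MvPowerSeries.WithPiTopology.hasSum_iff_hasSum_coeff.1 (hg.summable c m).hasSum d
  rw [FlaggedGrothendieck.betaSum, ← h.tsum_eq]
  convert tsum_zero with s
  rw [coeff_intCast_mul_beta_pow_mul, hM _ (by omega), mul_zero]

theorem EventuallyZero.add {g g' : ℤ → Ser} (hg : EventuallyZero g) (hg' : EventuallyZero g') :
    EventuallyZero fun m => g m + g' m := by
  intro d
  obtain ⟨M, hM⟩ := hg d
  obtain ⟨M', hM'⟩ := hg' d
  refine ⟨max M M', fun m hm => ?_⟩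
  rw [map_add, hM m (le_trans (le_max_left _ _) hm), hM' m (le_trans (le_max_right _ _) hm),
    add_zero]

theorem EventuallyZero.const_mul {g : ℤ → Ser} (hg : EventuallyZero g) (a : Ser) :
    EventuallyZero fun m => a * g m := by
  intro d
  choose M hM using hg
  classical
  obtain ⟨B, hB⟩ := ((Finset.HasAntidiagonal.antidiagonal d).image fun e => M e.2).bddAbove
  refine ⟨B, fun m hm => ?_⟩
  rw [MvPowerSeries.coeff_mul]
  refine Finset.sum_eq_zero fun e he => ?_
  rw [hM e.2 m (le_trans (hB (Finset.mem_coe.2 (Finset.mem_image_of_mem _ he))) hm), mul_zero]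

theorem EventuallyZero.shift {g : ℤ → Ser} (hg : EventuallyZero g) (a : ℤ) :
    EventuallyZero fun m => g (m + a) := by
  intro d
  obtain ⟨M, hM⟩ := hg d
  exact ⟨M - a, fun m hm => hM _ (by omega)⟩

theorem betaSum_add {g g' : ℤ → Ser} (hg : EventuallyZero g) (hg' : EventuallyZero g')
    (c : ℕ → ℤ) (m : ℤ) :
    betaSum c (fun m => g m + g' m) m = betaSum c g m + betaSum c g' m := by
  simp only [betaSum, mul_add]
  exact (hg.summable c m).tsum_add (hg'.summable c m)

theorem betaSum_const_mul {g : ℤ → Ser} (hg : EventuallyZero g) (a : Ser) (c : ℕ → ℤ) (m : ℤ) :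
    betaSum c (fun m => a * g m) m = a * betaSum c g m := by
  simp only [betaSum]
  rw [← (hg.summable c m).tsum_mul_left]
  exact tsum_congr fun s => by ring

theorem betaSum_shift (g : ℤ → Ser) (a : ℤ) (c : ℕ → ℤ) (m : ℤ) :
    betaSum c (fun m => g (m + a)) m = betaSum c g (m + a) := by
  simp only [betaSum]
  exact tsum_congr fun s => by rw [add_right_comm]

/-- A relation `g₁ = a g₂ + a' g₃(· - 1)` between two-sided series is inherited by their products
with a series in `β u⁻¹`. -/
theorem betaSum_linear {g₁ g₂ g₃ : ℤ → Ser} (h₂ : EventuallyZero g₂) (h₃ : EventuallyZero g₃)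
    {a a' : Ser} (h : ∀ m, g₁ m = a * g₂ m + a' * g₃ (m - 1)) (c : ℕ → ℤ) (m : ℤ) :
    betaSum c g₁ m = a * betaSum c g₂ m + a' * betaSum c g₃ (m - 1) := by
  have h' : g₁ = fun m => a * g₂ m + a' * g₃ (m + -1) := funext h
  rw [h', betaSum_add (h₂.const_mul a) ((h₃.shift (-1)).const_mul a'), betaSum_const_mul h₂,
    betaSum_const_mul (h₃.shift (-1)), betaSum_shift, sub_eq_add_neg]

/-! ### Recurrences for `uCoeff` and `calG` -/

theorem eventuallyZero_uCoeff (p q : ℕ) : EventuallyZero fun m => uCoeff m (genProd p q) := by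
  intro d
  refine ⟨d.degree + 1, fun m hm => MvPowerSeries.coeff_of_lt_order ?_⟩
  have h0 : 0 ≤ m := by omega
  beta_reduce
  rw [uCoeff, if_pos h0]
  refine lt_of_lt_of_le ?_ (orderGe_genProd p q _)
  have h1 : d.degree < m.toNat := by omega
  exact_mod_cast h1

theorem calG_eq_betaSum (m : ℤ) (p q : ℕ) :
    calG m p q = betaSum (fun k => (-1) ^ k) (fun m => uCoeff m (genProd p q)) m := by
  refine tsum_congr fun k => ?_
  rw [neg_pow beta]
  push_cast
  ring

theorem eventuallyZero_calG (p q : ℕ) : EventuallyZero fun m => calG m p q := by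
  simp only [calG_eq_betaSum]
  exact (eventuallyZero_uCoeff p q).betaSum _

theorem uCoeff_of_neg {m : ℤ} (hm : m < 0) (P : PowerSeries Ser) : uCoeff m P = 0 :=
  if_neg (by omega)

theorem uCoeff_add (m : ℤ) (P Q : PowerSeries Ser) :
    uCoeff m (P + Q) = uCoeff m P + uCoeff m Q := by
  rw [uCoeff, uCoeff, uCoeff]
  split_ifs <;> simp

theorem uCoeff_C_mul (m : ℤ) (a : Ser) (P : PowerSeries Ser) :
    uCoeff m (PowerSeries.C a * P) = a * uCoeff m P := by
  rw [uCoeff, uCoeff]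
  split_ifs <;> simp

theorem uCoeff_X_mul (m : ℤ) (P : PowerSeries Ser) :
    uCoeff m (PowerSeries.X * P) = uCoeff (m - 1) P := by
  rw [uCoeff, uCoeff]
  rcases lt_trichotomy m 0 with h | h | h
  · rw [if_neg (by omega), if_neg (by omega)]
  · subst h
    simp
  · rw [if_pos (by omega), if_pos (by omega)]
    have h1 : m.toNat = (m - 1).toNat + 1 := by omega
    rw [h1, PowerSeries.coeff_succ_X_mul]

theorem genProd_succ_right (p q : ℕ) :
    genProd p (q + 1) = PowerSeries.C (1 + beta * b (q + 1)) * genProd p q +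
      PowerSeries.C (b (q + 1)) * (PowerSeries.X * genProd p q) := by
  rw [genProd, Finset.prod_Icc_succ_top (Nat.le_add_left 1 q), ← mul_assoc, ← genProd]
  simp only [map_add, map_mul, map_one]
  ring

theorem genProd_succ_left (p q : ℕ) :
    genProd (p + 1) q = PowerSeries.C (1 + beta * x (p + 1)) * genProd p q +
      PowerSeries.C (x (p + 1)) * (PowerSeries.X * genProd (p + 1) q) := by
  have h : (1 - PowerSeries.C (x (p + 1)) * PowerSeries.X) * genProd (p + 1) q =
      PowerSeries.C (1 + beta * x (p + 1)) * genProd p q := by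
    rw [genProd, genProd, Finset.prod_Icc_succ_top (Nat.le_add_left 1 p)]
    linear_combination (∏ i ∈ Finset.Icc 1 p, PowerSeries.C (1 + beta * x i) * geom i) *
      PowerSeries.C (1 + beta * x (p + 1)) *
      (∏ i ∈ Finset.Icc 1 q, (1 + (PowerSeries.X + PowerSeries.C beta) * PowerSeries.C (b i))) *
      one_sub_mul_geom (p + 1)
  linear_combination h

theorem uCoeff_genProd_succ_right (m : ℤ) (p q : ℕ) :
    uCoeff m (genProd p (q + 1)) = (1 + beta * b (q + 1)) * uCoeff m (genProd p q) +
      b (q + 1) * uCoeff (m - 1) (genProd p q) := by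
  rw [genProd_succ_right, uCoeff_add, uCoeff_C_mul, uCoeff_C_mul, uCoeff_X_mul]

theorem uCoeff_genProd_succ_left (m : ℤ) (p q : ℕ) :
    uCoeff m (genProd (p + 1) q) = (1 + beta * x (p + 1)) * uCoeff m (genProd p q) +
      x (p + 1) * uCoeff (m - 1) (genProd (p + 1) q) := by
  conv_lhs => rw [genProd_succ_left, uCoeff_add, uCoeff_C_mul, uCoeff_C_mul, uCoeff_X_mul]

theorem calG_succ_right (m : ℤ) (p q : ℕ) :
    calG m p (q + 1) = (1 + beta * b (q + 1)) * calG m p q + b (q + 1) * calG (m - 1) p q := by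
  simp only [calG_eq_betaSum]
  exact betaSum_linear (eventuallyZero_uCoeff p q) (eventuallyZero_uCoeff p q)
    (fun m => uCoeff_genProd_succ_right m p q) _ _

theorem calG_succ_left (m : ℤ) (p q : ℕ) :
    calG m (p + 1) q = (1 + beta * x (p + 1)) * calG m p q +
      x (p + 1) * calG (m - 1) (p + 1) q := by
  simp only [calG_eq_betaSum]
  exact betaSum_linear (eventuallyZero_uCoeff p q) (eventuallyZero_uCoeff (p + 1) q)
    (fun m => uCoeff_genProd_succ_left m p q) _ _

theorem isUnit_one_add_beta_mul_x (i : ℕ) : IsUnit (1 + beta * x i) := by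
  rw [MvPowerSeries.isUnit_iff_constantCoeff]
  simp [x]

theorem calG_neg_one (p q : ℕ) : calG (-1) p q = -(beta * calG 0 p q) := by
  have h := calG_add_beta_mul (-1) p q
  rw [uCoeff_of_neg (by norm_num)] at h
  simpa using eq_neg_of_add_eq_zero_left h

/-- `𝒢_0` is the value of the generating product at `u = -β`, where every factor is `1`. -/
theorem calG_zero (p q : ℕ) : calG 0 p q = 1 := by
  induction q with
  | zero =>
    induction p with
    | zero =>
      rw [calG, tsum_eq_single 0]
      · simp [uCoeff, genProd]
      · intro k hk
        simp [uCoeff, genProd, PowerSeries.coeff_one, hk]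
    | succ p ih =>
      have h := calG_succ_left 0 p 0
      rw [zero_sub, calG_neg_one, ih] at h
      exact (isUnit_one_add_beta_mul_x (p + 1)).mul_left_cancel (by linear_combination h)
  | succ q ih =>
    have h := calG_succ_right 0 p q
    rw [zero_sub, calG_neg_one, ih] at h
    linear_combination h

theorem uCoeff_genProd_zero_left {m : ℤ} {q : ℕ} (hm : (q : ℤ) < m) :
    uCoeff m (genProd 0 q) = 0 := by
  induction q generalizing m with
  | zero =>
    have h0 : 0 ≤ m := by omega
    have h1 : m.toNat ≠ 0 := by omega
    simp [uCoeff, genProd, PowerSeries.coeff_one, h0, h1]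
  | succ q ih =>
    rw [uCoeff_genProd_succ_right, ih (by omega), ih (by omega)]
    simp

/-! ### The entries of the determinant -/

/-- The coefficient of `u ^ m` in `(1 + β u⁻¹) ^ d * ∑ m, 𝒢_m^{[p,q]} u ^ m`; a negative bound `q`
stands for an empty product. -/
def entrySum (d m : ℤ) (p : ℕ) (q : ℤ) : Ser :=
  betaSum (fun s => Ring.choose d s) (fun m => calG m p q.toNat) m

/-- The variable `b_z` for `z ≥ 1`, and `0` for the integers `z ≤ 0`, whose factors are missing
from the generating product. -/
def bInt (z : ℤ) : Ser := if 1 ≤ z then b z.toNat else 0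

theorem entrySum_right (d m : ℤ) (p : ℕ) (z : ℤ) :
    entrySum d m p z = (1 + beta * bInt z) * entrySum d m p (z - 1) +
      bInt z * entrySum d (m - 1) p (z - 1) := by
  unfold bInt
  split_ifs with h
  · have hz : z.toNat = (z - 1).toNat + 1 := by omega
    have hG := eventuallyZero_calG p (z - 1).toNat
    simp only [entrySum, hz]
    exact betaSum_linear hG hG (fun m => calG_succ_right m p _) _ _
  · have hz : z.toNat = (z - 1).toNat := by omega
    rw [entrySum, entrySum, hz]
    ring

theorem entrySum_succ_left (d m : ℤ) (p : ℕ) (z : ℤ) :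
    entrySum d m (p + 1) z = (1 + beta * x (p + 1)) * entrySum d m p z +
      x (p + 1) * entrySum d (m - 1) (p + 1) z :=
  betaSum_linear (eventuallyZero_calG _ _) (eventuallyZero_calG _ _)
    (fun m => calG_succ_left m p _) _ _

/-- Pascal's rule: multiplication by `1 + β u⁻¹` raises the exponent `d`. -/
theorem entrySum_pascal (d m : ℤ) (p : ℕ) (z : ℤ) :
    entrySum (d + 1) m p z = entrySum d m p z + beta * entrySum d (m + 1) p z := by
  have hG := eventuallyZero_calG p z.toNat
  simp only [entrySum, betaSum]
  rw [(hG.summable (fun s => Ring.choose (d + 1) s) m).tsum_eq_zero_add,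
    (hG.summable (fun s => Ring.choose d s) m).tsum_eq_zero_add,
    ← (hG.summable (fun s => Ring.choose d s) (m + 1)).tsum_mul_left, add_assoc,
    ← Summable.tsum_add]
  · congr 1
    · simp
    · refine tsum_congr fun s => ?_
      rw [Ring.choose_succ_succ]
      push_cast
      rw [show m + ((s : ℤ) + 1) = m + 1 + s by ring]
      ring
  · exact (summable_nat_add_iff 1).2 (hG.summable (fun s => Ring.choose d s) m)
  · exact (hG.summable _ _).mul_left _

theorem entrySum_zero (m : ℤ) (p : ℕ) (z : ℤ) : entrySum 0 m p z = calG m p z.toNat := by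
  rw [entrySum, betaSum, tsum_eq_single 0]
  · simp
  · intro s hs
    rw [Ring.choose_zero_pos ℤ (Nat.pos_of_ne_zero hs)]
    simp

theorem entrySum_of_le_neg {d : ℕ} {m : ℤ} (hm : m ≤ -(d + 1 : ℤ)) (p : ℕ) (z : ℤ) :
    entrySum (d + 1) m p z = 0 := by
  induction d generalizing m with
  | zero =>
    have h := entrySum_pascal 0 m p z
    rw [entrySum_zero, entrySum_zero, calG_add_beta_mul, uCoeff_of_neg (by omega)] at h
    exact_mod_cast h
  | succ d ih =>
    have h := entrySum_pascal (d + 1) m p z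
    rw [ih (by push_cast at hm; omega), ih (by push_cast at hm; omega), mul_zero, add_zero] at h
    exact_mod_cast h

theorem entrySum_zero_left {q m : ℤ} (hm : q < m) (hm0 : 0 < m) (d : ℤ) :
    entrySum d m 0 q = 0 := by
  rw [entrySum, betaSum]
  convert tsum_zero with s
  rw [calG]
  convert mul_zero _
  convert tsum_zero with k
  rw [uCoeff_genProd_zero_left (by omega), mul_zero]

/-- Removal of the last box, in its generating function form: with `w = u + β`,
`1 + b w = (1 + β b) (1 - x u) + (x ⊕ b) u`. -/
theorem entrySum_box (d m : ℤ) (n : ℕ) (z : ℤ) :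
    entrySum d (m + 1) (n + 1) z =
      (1 + beta * (x (n + 1) + bInt z + beta * x (n + 1) * bInt z)) *
        entrySum d (m + 1) n (z - 1) +
      (x (n + 1) + bInt z + beta * x (n + 1) * bInt z) * entrySum d m (n + 1) (z - 1) := by
  have h1 := entrySum_right d (m + 1) (n + 1) z
  have h2 := entrySum_succ_left d (m + 1) n (z - 1)
  rw [add_sub_cancel_right] at h1 h2
  linear_combination h1 + (1 + beta * bInt z) * h2

/-- Lowering the flag changes an entry by a multiple, independent of `d` and `m`, of the entry with
`d + 1` and `m - 1`: with `w = u + β` and `y = x / (1 + β x)`,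
`(1 + b w) - (b + y) w = 1 - y w = (1 - x u) / (1 + β x)`. -/
theorem exists_entrySum_flag (n : ℕ) (z : ℤ) :
    ∃ c : Ser, ∀ d m : ℤ, entrySum d m (n + 1) z =
      entrySum d m n (z - 1) + c * entrySum (d + 1) (m - 1) (n + 1) (z - 1) := by
  obtain ⟨v, hv⟩ := (isUnit_one_add_beta_mul_x (n + 1)).exists_left_inv
  refine ⟨bInt z + v * x (n + 1), fun d m => ?_⟩
  have h1 := entrySum_right d m (n + 1) z
  have h2 := entrySum_succ_left d m n (z - 1)
  have h3 := entrySum_pascal d (m - 1) (n + 1) (z - 1)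
  rw [sub_add_cancel] at h3
  rw [h3]
  linear_combination h1 + v * h2 +
    (entrySum d m n (z - 1) - entrySum d m (n + 1) (z - 1)) * hv

/-! ### Sums over tableaux with arbitrary weights -/

section Tableaux

variable {R : Type*} [CommRing R] {r : ℕ} {lam f : Fin r → ℕ}

/-- The contribution of a box with 0-based row `i` and column `j` and with set of entries `A`, where
`wt i j v` is the weight of an entry `v`. -/
def boxWeight (bet : R) (wt : ℕ → ℕ → ℕ → R) (c : Box lam) (A : Finset ℕ) : R :=
  bet ^ (A.card - 1) * ∏ v ∈ A, wt c.1 c.2 v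

/-- The generating function of the tableaux of `(lam, f)` for the entry weights `wt`. -/
def tableauSum (bet : R) (wt : ℕ → ℕ → ℕ → R) (lam f : Fin r → ℕ) : R :=
  ∑ T ∈ tableaux lam f, ∏ c, boxWeight bet wt c (T c)

theorem IsTableau.le_of_lt {T : Box lam → Finset ℕ} (hT : IsTableau lam f T) {i : Fin r}
    {j j' : ℕ} (hj : j < lam i) (hj' : j' < lam i) (h : j < j') {u v : ℕ}
    (hu : u ∈ T ⟨i, ⟨j, hj⟩⟩) (hv : v ∈ T ⟨i, ⟨j', hj'⟩⟩) : u ≤ v := by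
  induction j', h using Nat.le_induction generalizing v with
  | base => exact hT.row_weak ⟨i, ⟨j, hj⟩⟩ ⟨i, ⟨j + 1, hj'⟩⟩ rfl rfl u hu v hv
  | succ l hl ih =>
    obtain ⟨w, hw⟩ := hT.nonempty ⟨i, ⟨l, by omega⟩⟩
    exact (ih (by omega) hw).trans
      (hT.row_weak ⟨i, ⟨l, by omega⟩⟩ ⟨i, ⟨l + 1, hj'⟩⟩ rfl rfl w hw v hv)

/-- If `f k = n + 1`, lowering this flag to `n` selects the tableaux without `n + 1` in row `k`. -/
theorem isTableau_update_flag {k : Fin r} {n : ℕ} (hk : f k = n + 1) {T : Box lam → Finset ℕ} :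
    IsTableau lam (Function.update f k n) T ↔
      IsTableau lam f T ∧ ∀ j, n + 1 ∉ T ⟨k, j⟩ := by
  constructor
  · intro h
    refine ⟨⟨h.nonempty, fun c => (h.flag c).trans ?_, h.row_weak, h.col_strict⟩, fun j hj => ?_⟩
    · refine Finset.Icc_subset_Icc_right ?_
      rcases eq_or_ne c.1 k with h1 | h1
      · rw [h1, Function.update_self, hk]
        exact Nat.le_succ n
      · rw [Function.update_of_ne h1]
    · have := (Finset.mem_Icc.1 (h.flag _ hj)).2
      simp only [Function.update_self] at this
      omega
  · rintro ⟨h, h'⟩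
    refine ⟨h.nonempty, ?_, h.row_weak, h.col_strict⟩
    rintro ⟨i, j⟩ v hv
    have h1 := Finset.mem_Icc.1 (h.flag _ hv)
    rcases eq_or_ne i k with h2 | h2
    · subst h2
      have h3 : v ≠ n + 1 := fun h3 => h' j (h3 ▸ hv)
      simp only [Function.update_self, Finset.mem_Icc]
      simp only [hk] at h1
      omega
    · simp only [Function.update_of_ne h2, Finset.mem_Icc]
      exact h1

/-- If row `k` is empty, or lies above a row of the same length and flag, then its flag is never
attained. -/
theorem tableauSum_update_flag (bet : R) (wt : ℕ → ℕ → ℕ → R) {k : Fin r} {n : ℕ}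
    (hk : f k = n + 1)
    (h : lam k = 0 ∨ ∃ k' : Fin r, (k' : ℕ) = k + 1 ∧ lam k' = lam k ∧ f k' = f k) :
    tableauSum bet wt lam f = tableauSum bet wt lam (Function.update f k n) := by
  have : tableaux lam f = tableaux lam (Function.update f k n) := by
    ext T
    rw [mem_tableaux, mem_tableaux, isTableau_update_flag hk, iff_self_and]
    intro hT j hj
    rcases h with h | ⟨k', h1, h2, h3⟩
    · exact absurd j.2 (by omega)
    · have hj' : (j : ℕ) < lam k' := by omega
      obtain ⟨v, hv⟩ := hT.nonempty ⟨k', ⟨j, hj'⟩⟩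
      have h4 := hT.col_strict ⟨k, j⟩ ⟨k', ⟨j, hj'⟩⟩ (by simp [Box.row, h1]) rfl _ hj v hv
      have h5 := (Finset.mem_Icc.1 (hT.flag _ hv)).2
      simp only at h5
      omega
  rw [tableauSum, this, tableauSum]

/-- Suppose that the row of `c₀` is strictly longer than the next one and that `c₀` is its last box.
The entries of `c₀` can be replaced by any nonempty set whose elements are old entries, or equal to
the flag of the row if this is larger than the flag of the previous row. -/
theorem IsTableau.update_last {c₀ : Box lam} (hlast : (c₀.2 : ℕ) + 1 = lam c₀.1)
    (hbelow : ∀ i : Fin r, (i : ℕ) = c₀.1 + 1 → lam i ≤ c₀.2)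
    (habove : ∀ i : Fin r, (i : ℕ) + 1 = c₀.1 → f i < f c₀.1)
    {T : Box lam → Finset ℕ} (hT : IsTableau lam f T) {B : Finset ℕ} (hB : B.Nonempty)
    (hBf : B ⊆ insert (f c₀.1) (T c₀)) :
    IsTableau lam f (Function.update T c₀ B) := by
  have hpos : 1 ≤ f c₀.1 := by
    obtain ⟨v, hv⟩ := hT.nonempty c₀
    have := Finset.mem_Icc.1 (hT.flag _ hv)
    omega
  refine ⟨fun c => ?_, fun c => ?_, ?_, ?_⟩
  · rcases eq_or_ne c c₀ with rfl | h
    · rwa [Function.update_self]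
    · rw [Function.update_of_ne h]
      exact hT.nonempty c
  · rcases eq_or_ne c c₀ with rfl | h
    · rw [Function.update_self]
      exact hBf.trans (Finset.insert_subset (Finset.mem_Icc.2 ⟨hpos, le_rfl⟩) (hT.flag c))
    · rw [Function.update_of_ne h]
      exact hT.flag c
  · intro c d h1 h2 u hu v hv
    have hc : c ≠ c₀ := by
      rintro rfl
      have h3 : d.1 = c.1 := Fin.ext (by simpa [Box.row] using h1)
      have h4 : (d.2 : ℕ) < lam d.1 := d.2.2
      have h5 : lam d.1 = lam c.1 := congrArg lam h3
      simp only [Box.col] at h2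
      omega
    rw [Function.update_of_ne hc] at hu
    rcases eq_or_ne d c₀ with rfl | h
    · rw [Function.update_self] at hv
      rcases Finset.mem_insert.1 (hBf hv) with rfl | h3
      · have h5 : c.1 = d.1 := Fin.ext (by simpa [Box.row] using h1.symm)
        have h4 := (Finset.mem_Icc.1 (hT.flag _ hu)).2
        rwa [h5] at h4
      · exact hT.row_weak _ _ h1 h2 u hu v h3
    · rw [Function.update_of_ne h] at hv
      exact hT.row_weak _ _ h1 h2 u hu v hv
  · intro c d h1 h2 u hu v hv
    have hc : c ≠ c₀ := by
      rintro rfl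
      have h3 := hbelow d.1 (by simpa [Box.row] using h1)
      have h4 : (d.2 : ℕ) < lam d.1 := d.2.2
      simp only [Box.col] at h2
      omega
    rw [Function.update_of_ne hc] at hu
    rcases eq_or_ne d c₀ with rfl | h
    · rw [Function.update_self] at hv
      rcases Finset.mem_insert.1 (hBf hv) with rfl | h3
      · have h4 := (Finset.mem_Icc.1 (hT.flag _ hu)).2
        exact h4.trans_lt (habove c.1 (by simpa [Box.row] using h1.symm))
      · exact hT.col_strict _ _ h1 h2 u hu v h3
    · rw [Function.update_of_ne h] at hv
      exact hT.col_strict _ _ h1 h2 u hu v hv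

/-- The row lengths after removal of the box `c₀` from the end of its row. -/
abbrev dropBox (c₀ : Box lam) : Fin r → ℕ := Function.update lam c₀.1 c₀.2

theorem dropBox_le (c₀ : Box lam) (i : Fin r) : dropBox c₀ i ≤ lam i := by
  rcases eq_or_ne i c₀.1 with rfl | h
  · rw [dropBox, Function.update_self]
    exact c₀.2.2.le
  · rw [dropBox, Function.update_of_ne h]

theorem lt_dropBox_iff {c₀ : Box lam} (hlast : (c₀.2 : ℕ) + 1 = lam c₀.1) (c : Box lam) :
    (c.2 : ℕ) < dropBox c₀ c.1 ↔ c ≠ c₀ := by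
  obtain ⟨i, j⟩ := c
  rcases eq_or_ne i c₀.1 with rfl | h
  · have hj : (j : ℕ) < lam c₀.1 := j.2
    have h' : (⟨c₀.1, j⟩ : Box lam) = c₀ ↔ (j : ℕ) = c₀.2 :=
      ⟨fun h => congrArg (fun c : Box lam => (c.2 : ℕ)) h, fun h => Sigma.ext rfl (heq_of_eq (Fin.ext h))⟩
    simp only [dropBox, Function.update_self, Ne, h']
    omega
  · simp only [dropBox, Function.update_of_ne h, Fin.is_lt, true_iff]
    rintro rfl
    exact h rfl

/-- The inclusion of the diagram without `c₀` into the diagram of `lam`. -/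
def incl {c₀ : Box lam} (c : Box (dropBox c₀)) : Box lam :=
  ⟨c.1, ⟨c.2, lt_of_lt_of_le c.2.2 (dropBox_le c₀ c.1)⟩⟩

/-- The filling of the diagram of `lam` with the set `B` in the box `c₀` that extends `T`. -/
def extend (c₀ : Box lam) (B : Finset ℕ) (T : Box (dropBox c₀) → Finset ℕ) (c : Box lam) :
    Finset ℕ :=
  if h : (c.2 : ℕ) < dropBox c₀ c.1 then T ⟨c.1, ⟨c.2, h⟩⟩ else B

theorem extend_incl {c₀ : Box lam} (B : Finset ℕ) (T : Box (dropBox c₀) → Finset ℕ)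
    (c : Box (dropBox c₀)) : extend c₀ B T (incl c) = T c :=
  dif_pos c.2.2

theorem extend_self {c₀ : Box lam} (hlast : (c₀.2 : ℕ) + 1 = lam c₀.1) (B : Finset ℕ)
    (T : Box (dropBox c₀) → Finset ℕ) : extend c₀ B T c₀ = B :=
  dif_neg fun h => (lt_dropBox_iff hlast c₀).1 h rfl

theorem exists_incl_eq {c₀ : Box lam} (hlast : (c₀.2 : ℕ) + 1 = lam c₀.1) {c : Box lam}
    (h : c ≠ c₀) : ∃ c' : Box (dropBox c₀), (incl c') = c :=
  ⟨⟨c.1, ⟨c.2, (lt_dropBox_iff hlast c).2 h⟩⟩, rfl⟩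

theorem incl_ne {c₀ : Box lam} (hlast : (c₀.2 : ℕ) + 1 = lam c₀.1) (c : Box (dropBox c₀)) :
    (incl c) ≠ c₀ :=
  (lt_dropBox_iff hlast (incl c)).1 c.2.2

theorem incl_injective {c₀ : Box lam} :
    Function.Injective (incl : Box (dropBox c₀) → Box lam) := by
  rintro ⟨i, j⟩ ⟨i', j'⟩ h
  obtain rfl : i = i' := congrArg Sigma.fst h
  have h2 : (j : ℕ) = j' := congrArg (fun c : Box lam => (c.2 : ℕ)) h
  rw [Fin.ext h2]

theorem IsTableau.comp_incl {c₀ : Box lam} {T : Box lam → Finset ℕ} (hT : IsTableau lam f T) :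
    IsTableau (dropBox c₀) f (T ∘ incl) :=
  ⟨fun c => hT.nonempty (incl c), fun c => hT.flag (incl c),
    fun c d h1 h2 => hT.row_weak (incl c) (incl d) h1 h2,
    fun c d h1 h2 => hT.col_strict (incl c) (incl d) h1 h2⟩

theorem IsTableau.extend {c₀ : Box lam} (hlast : (c₀.2 : ℕ) + 1 = lam c₀.1)
    (hbelow : ∀ i : Fin r, (i : ℕ) = c₀.1 + 1 → lam i ≤ c₀.2)
    (habove : ∀ i : Fin r, (i : ℕ) + 1 = c₀.1 → f i < f c₀.1) (hpos : 1 ≤ f c₀.1)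
    {T : Box (dropBox c₀) → Finset ℕ} (hT : IsTableau (dropBox c₀) f T) :
    IsTableau lam f (extend c₀ {f c₀.1} T) := by
  refine ⟨fun c => ?_, fun c => ?_, ?_, ?_⟩
  · rcases eq_or_ne c c₀ with rfl | h
    · rw [extend_self hlast]
      exact Finset.singleton_nonempty _
    · obtain ⟨c, rfl⟩ := exists_incl_eq hlast h
      rw [extend_incl]
      exact hT.nonempty c
  · rcases eq_or_ne c c₀ with rfl | h
    · rw [extend_self hlast, Finset.singleton_subset_iff]
      exact Finset.mem_Icc.2 ⟨hpos, le_rfl⟩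
    · obtain ⟨c, rfl⟩ := exists_incl_eq hlast h
      rw [extend_incl]
      exact hT.flag c
  · intro c d h1 h2 u hu v hv
    have hc : c ≠ c₀ := by
      rintro rfl
      have h3 : d.1 = c.1 := Fin.ext (by simpa [Box.row] using h1)
      have h4 : (d.2 : ℕ) < lam d.1 := d.2.2
      have h5 : lam d.1 = lam c.1 := congrArg lam h3
      simp only [Box.col] at h2
      omega
    obtain ⟨c, rfl⟩ := exists_incl_eq hlast hc
    rw [extend_incl] at hu
    rcases eq_or_ne d c₀ with rfl | h
    · rw [extend_self hlast, Finset.mem_singleton] at hv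
      have h5 : c.1 = d.1 := Fin.ext (by simpa [Box.row, incl] using h1.symm)
      have h4 := (Finset.mem_Icc.1 (hT.flag _ hu)).2
      rwa [h5, ← hv] at h4
    · obtain ⟨d, rfl⟩ := exists_incl_eq hlast h
      rw [extend_incl] at hv
      exact hT.row_weak _ _ h1 h2 u hu v hv
  · intro c d h1 h2 u hu v hv
    have hc : c ≠ c₀ := by
      rintro rfl
      have h3 := hbelow d.1 (by simpa [Box.row] using h1)
      have h4 : (d.2 : ℕ) < lam d.1 := d.2.2
      simp only [Box.col] at h2
      omega
    obtain ⟨c, rfl⟩ := exists_incl_eq hlast hc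
    rw [extend_incl] at hu
    rcases eq_or_ne d c₀ with rfl | h
    · rw [extend_self hlast, Finset.mem_singleton] at hv
      rw [hv]
      have h4 := (Finset.mem_Icc.1 (hT.flag _ hu)).2
      exact h4.trans_lt (habove c.1 (by simpa [Box.row, incl] using h1.symm))
    · obtain ⟨d, rfl⟩ := exists_incl_eq hlast h
      rw [extend_incl] at hv
      exact hT.col_strict _ _ h1 h2 u hu v hv

theorem prod_erase_eq_prod_incl {c₀ : Box lam} (hlast : (c₀.2 : ℕ) + 1 = lam c₀.1)
    (F : Box lam → R) :
    ∏ c ∈ Finset.univ.erase c₀, F c = ∏ c : Box (dropBox c₀), F (incl c) := by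
  symm
  refine Finset.prod_bij (fun c _ => (incl c))
    (fun c _ => Finset.mem_erase.2 ⟨incl_ne hlast c, Finset.mem_univ _⟩)
    (fun _ _ _ _ h => incl_injective h) (fun c hc => ?_) (fun _ _ => rfl)
  obtain ⟨c', hc'⟩ := exists_incl_eq hlast (Finset.mem_erase.1 hc).1
  exact ⟨c', Finset.mem_univ _, hc'⟩

/-- The generating function of the tableaux whose box `c₀` has the flag as its only entry. -/
theorem sum_tableaux_last_eq_singleton (bet : R) (wt : ℕ → ℕ → ℕ → R)
    {c₀ : Box lam} (hlast : (c₀.2 : ℕ) + 1 = lam c₀.1)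
    (hbelow : ∀ i : Fin r, (i : ℕ) = c₀.1 + 1 → lam i ≤ c₀.2)
    (habove : ∀ i : Fin r, (i : ℕ) + 1 = c₀.1 → f i < f c₀.1) (hpos : 1 ≤ f c₀.1) :
    ∑ T ∈ tableaux lam f with T c₀ = {f c₀.1}, ∏ c, boxWeight bet wt c (T c) =
      wt c₀.1 c₀.2 (f c₀.1) * tableauSum bet wt (dropBox c₀) f := by
  rw [tableauSum, Finset.mul_sum]
  refine Finset.sum_nbij' (fun T => T ∘ incl) (FlaggedGrothendieck.extend c₀ {f c₀.1})
    (fun T hT => ?_) (fun T hT => ?_) (fun T hT => ?_) (fun T hT => ?_) (fun T hT => ?_)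
  · exact mem_tableaux.2 (mem_tableaux.1 (Finset.mem_filter.1 hT).1).comp_incl
  · exact Finset.mem_filter.2 ⟨mem_tableaux.2 ((mem_tableaux.1 hT).extend hlast hbelow habove hpos),
      extend_self hlast _ _⟩
  · funext c
    rcases eq_or_ne c c₀ with rfl | h
    · rw [extend_self hlast, (Finset.mem_filter.1 hT).2]
    · obtain ⟨c, rfl⟩ := exists_incl_eq hlast h
      rw [extend_incl, Function.comp_apply]
  · funext c
    rw [Function.comp_apply, extend_incl]
  · rw [← Finset.mul_prod_erase _ _ (Finset.mem_univ c₀), prod_erase_eq_prod_incl hlast,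
      (Finset.mem_filter.1 hT).2]
    congr 1
    simp [boxWeight]

/-- The generating function of the tableaux whose box `c₀` contains the flag of its row and other
entries. -/
theorem sum_tableaux_mem_last (bet : R) (wt : ℕ → ℕ → ℕ → R)
    {c₀ : Box lam} (hlast : (c₀.2 : ℕ) + 1 = lam c₀.1)
    (hbelow : ∀ i : Fin r, (i : ℕ) = c₀.1 + 1 → lam i ≤ c₀.2)
    (habove : ∀ i : Fin r, (i : ℕ) + 1 = c₀.1 → f i < f c₀.1) :
    ∑ T ∈ tableaux lam f with f c₀.1 ∈ T c₀ ∧ T c₀ ≠ {f c₀.1}, ∏ c, boxWeight bet wt c (T c) =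
      bet * wt c₀.1 c₀.2 (f c₀.1) *
        ∑ T ∈ tableaux lam f with f c₀.1 ∉ T c₀, ∏ c, boxWeight bet wt c (T c) := by
  rw [Finset.mul_sum]
  refine Finset.sum_nbij' (fun T => Function.update T c₀ ((T c₀).erase (f c₀.1)))
    (fun T => Function.update T c₀ (insert (f c₀.1) (T c₀)))
    (fun T hT => ?_) (fun T hT => ?_) (fun T hT => ?_) (fun T hT => ?_) (fun T hT => ?_)
  · obtain ⟨h1, h2, h3⟩ := Finset.mem_filter.1 hT
    refine Finset.mem_filter.2 ⟨mem_tableaux.2 ?_, ?_⟩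
    · refine (mem_tableaux.1 h1).update_last hlast hbelow habove ?_ ?_
      · rw [Finset.nonempty_iff_ne_empty, Ne, Finset.erase_eq_empty_iff]
        rintro (h4 | h4)
        · simp [h4] at h2
        · exact h3 h4
      · exact (Finset.erase_subset _ _).trans (Finset.subset_insert _ _)
    · rw [Function.update_self]
      exact Finset.notMem_erase _ _
  · obtain ⟨h1, h2⟩ := Finset.mem_filter.1 hT
    refine Finset.mem_filter.2 ⟨mem_tableaux.2 ?_, ?_, ?_⟩
    · exact (mem_tableaux.1 h1).update_last hlast hbelow habove (Finset.insert_nonempty _ _)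
        subset_rfl
    · rw [Function.update_self]
      exact Finset.mem_insert_self _ _
    · rw [Function.update_self]
      intro h3
      obtain ⟨v, hv⟩ := (mem_tableaux.1 h1).nonempty c₀
      have h4 : v ∈ ({f c₀.1} : Finset ℕ) := h3 ▸ Finset.mem_insert_of_mem hv
      exact h2 (Finset.mem_singleton.1 h4 ▸ hv)
  · obtain ⟨h1, h2, h3⟩ := Finset.mem_filter.1 hT
    simp [Finset.insert_erase h2]
  · obtain ⟨h1, h2⟩ := Finset.mem_filter.1 hT
    simp [Finset.erase_insert h2]
  · obtain ⟨h1, h2, h3⟩ := Finset.mem_filter.1 hT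
    have hcard : 2 ≤ (T c₀).card := by
      by_contra hlt
      have h4 : 0 < (T c₀).card := Finset.card_pos.2 ⟨_, h2⟩
      obtain ⟨a, ha⟩ := Finset.card_eq_one.1 (by omega : (T c₀).card = 1)
      rw [ha, Finset.mem_singleton] at h2
      exact h3 (h2 ▸ ha)
    rw [← Finset.mul_prod_erase _ _ (Finset.mem_univ c₀),
      ← Finset.mul_prod_erase _ (fun c => boxWeight bet wt c (Function.update T c₀ _ c))
        (Finset.mem_univ c₀), ← mul_assoc, Function.update_self]
    congr 1
    · rw [boxWeight, boxWeight, Finset.card_erase_of_mem h2,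
        ← Finset.mul_prod_erase _ _ h2]
      obtain ⟨e, he⟩ := Nat.exists_eq_add_of_le hcard
      rw [he, show 2 + e - 1 = e + 1 by omega, show e + 1 - 1 = e by omega]
      ring
    · refine Finset.prod_congr rfl fun c hc => ?_
      rw [Function.update_of_ne (Finset.mem_erase.1 hc).1]

/-- Recursion at the last box `c₀` of a row that is longer than the next one and has a larger flag
than the previous one. By the row condition, the flag of the row is an entry of the row if and only
if it is an entry of `c₀`. -/
theorem tableauSum_last_box (bet : R) (wt : ℕ → ℕ → ℕ → R)
    {c₀ : Box lam} (hlast : (c₀.2 : ℕ) + 1 = lam c₀.1)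
    (hbelow : ∀ i : Fin r, (i : ℕ) = c₀.1 + 1 → lam i ≤ c₀.2)
    (habove : ∀ i : Fin r, (i : ℕ) + 1 = c₀.1 → f i < f c₀.1) {n : ℕ} (hn : f c₀.1 = n + 1) :
    tableauSum bet wt lam f =
      (1 + bet * wt c₀.1 c₀.2 (n + 1)) * tableauSum bet wt lam (Function.update f c₀.1 n) +
        wt c₀.1 c₀.2 (n + 1) * tableauSum bet wt (dropBox c₀) f := by
  have h0 : tableauSum bet wt lam (Function.update f c₀.1 n) =
      ∑ T ∈ tableaux lam f with f c₀.1 ∉ T c₀, ∏ c, boxWeight bet wt c (T c) := by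
    rw [tableauSum]
    congr 1
    ext T
    rw [Finset.mem_filter, mem_tableaux, mem_tableaux, isTableau_update_flag hn, hn]
    refine and_congr_right fun hT => ⟨fun h => h c₀.2, fun h j hj => ?_⟩
    rcases Nat.lt_or_ge j c₀.2 with h1 | h1
    · obtain ⟨v, hv⟩ := hT.nonempty c₀
      have h2 := hT.le_of_lt j.2 c₀.2.2 h1 hj hv
      have h3 := (Finset.mem_Icc.1 (hT.flag _ hv)).2
      exact h ((by omega : v = n + 1) ▸ hv)
    · have h2 : j = c₀.2 := Fin.ext (by omega)
      subst h2
      exact h hj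
  have h1 := sum_tableaux_last_eq_singleton bet wt hlast hbelow habove (by omega)
  have h2 := sum_tableaux_mem_last bet wt hlast hbelow habove
  have h3 := Finset.sum_filter_add_sum_filter_not (tableaux lam f) (fun T => f c₀.1 ∈ T c₀)
    (fun T => ∏ c, boxWeight bet wt c (T c))
  have h4 := Finset.sum_filter_add_sum_filter_not
    ((tableaux lam f).filter fun T => f c₀.1 ∈ T c₀) (fun T => T c₀ = {f c₀.1})
    (fun T => ∏ c, boxWeight bet wt c (T c))
  rw [Finset.filter_filter, Finset.filter_filter, h2, ← h0,
    Finset.filter_congr (q := fun T => T c₀ = {f c₀.1})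
      (fun T _ => ⟨fun h => h.2, fun h => ⟨h ▸ Finset.mem_singleton_self _, h⟩⟩), h1, hn] at h4
  rw [← h0, hn] at h3
  rw [tableauSum, ← h3, ← h4]
  ring

end Tableaux

/-! ### The determinant and its recursion -/

theorem entrySum_empty_row (d p : ℕ) (z : ℤ) :
    entrySum d (-d) p z = if d = 0 then 1 else 0 := by
  rcases d with _ | d
  · simpa [calG_zero] using entrySum_zero 0 p z
  · rw [if_neg (Nat.succ_ne_zero d)]
    push_cast
    exact entrySum_of_le_neg le_rfl p z

variable {r : ℕ} {lam f : Fin r → ℕ}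

/-- The matrix of the determinantal formula. -/
def entryMatrix (lam f : Fin r → ℕ) : Matrix (Fin r) (Fin r) Ser :=
  Matrix.of fun i j => entrySum ((i : ℤ) - (j : ℤ)) ((lam i : ℤ) - (i : ℤ) + (j : ℤ)) (f i)
    ((f i : ℤ) + (lam i : ℤ) - ((i : ℤ) + 1))

/-- The weight `x_v ⊕ b_{v + col - row}` of an entry `v` in 0-based row `i` and column `j`, as a
power series. -/
def serWeight (i j v : ℕ) : Ser :=
  x v + bInt ((v : ℤ) + j - i) + beta * x v * bInt ((v : ℤ) + j - i)

theorem updateRow_entryMatrix_congr {lam' f' : Fin r → ℕ} {k : Fin r}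
    (hl : ∀ i ≠ k, lam i = lam' i) (hf : ∀ i ≠ k, f i = f' i) (v : Fin r → Ser) :
    (entryMatrix lam f).updateRow k v = (entryMatrix lam' f').updateRow k v := by
  ext1 i j
  rcases eq_or_ne i k with rfl | h
  · simp
  · simp [Matrix.updateRow_ne h, entryMatrix, hl i h, hf i h]

theorem det_entryMatrix_last_box {k : Fin r} {m n : ℕ} (hm : lam k = m + 1) (hn : f k = n + 1) :
    (entryMatrix lam f).det =
      (1 + beta * serWeight k m (n + 1)) * (entryMatrix lam (Function.update f k n)).det +
        serWeight k m (n + 1) * (entryMatrix (Function.update lam k m) f).det := by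
  have h1 : entryMatrix lam f = (entryMatrix lam f).updateRow k
      ((1 + beta * serWeight k m (n + 1)) • entryMatrix lam (Function.update f k n) k +
        serWeight k m (n + 1) • entryMatrix (Function.update lam k m) f k) := by
    conv_lhs => rw [← Matrix.updateRow_eq_self (entryMatrix lam f) k]
    congr 1
    funext j
    have h := entrySum_box ((k : ℤ) - j) ((m : ℤ) - k + j) n ((n : ℤ) + 1 + m - k)
    simp only [entryMatrix, Matrix.of_apply, Pi.add_apply, Pi.smul_apply, smul_eq_mul,
      Function.update_self, serWeight, hm, hn]
    rw [show ((m + 1 : ℕ) : ℤ) - k + j = m - k + j + 1 by push_cast; ring,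
      show ((n + 1 : ℕ) : ℤ) + (m + 1 : ℕ) - (k + 1) = n + 1 + m - k by push_cast; ring,
      show (n : ℤ) + (m + 1 : ℕ) - (k + 1) = n + 1 + m - k - 1 by push_cast; ring,
      show ((n + 1 : ℕ) : ℤ) + m - (k + 1) = n + 1 + m - k - 1 by push_cast; ring,
      show ((n + 1 : ℕ) : ℤ) + m - k = n + 1 + m - k by push_cast; ring]
    exact h
  have h2 : (entryMatrix lam f).updateRow k (entryMatrix lam (Function.update f k n) k) =
      entryMatrix lam (Function.update f k n) := by
    rw [updateRow_entryMatrix_congr (fun _ _ => rfl)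
      (fun i hi => (Function.update_of_ne hi n f).symm), Matrix.updateRow_eq_self]
  have h3 : (entryMatrix lam f).updateRow k (entryMatrix (Function.update lam k m) f k) =
      entryMatrix (Function.update lam k m) f := by
    rw [updateRow_entryMatrix_congr (fun i hi => (Function.update_of_ne hi m lam).symm)
      (fun _ _ => rfl), Matrix.updateRow_eq_self]
  rw [h1, Matrix.det_updateRow_add, Matrix.det_updateRow_smul, Matrix.det_updateRow_smul, h2, h3]

/-- Lowering the flag of a row that lies above a row of the same length and flag amounts to the
subtraction of a multiple of the lower row. -/
theorem det_entryMatrix_update_flag {k k' : Fin r} {n : ℕ} (hn : f k = n + 1)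
    (hk : (k' : ℕ) = k + 1) (hl : lam k' = lam k) (hf : f k' = f k) :
    (entryMatrix lam f).det = (entryMatrix lam (Function.update f k n)).det := by
  have hne : k ≠ k' := fun h => by
    have := congrArg Fin.val h
    omega
  obtain ⟨c, hc⟩ := exists_entrySum_flag n ((n : ℤ) + 1 + lam k - (k + 1))
  have h1 : entryMatrix lam f = (entryMatrix lam (Function.update f k n)).updateRow k
      (entryMatrix lam (Function.update f k n) k +
        c • entryMatrix lam (Function.update f k n) k') := by
    rw [← updateRow_entryMatrix_congr (lam := lam) (f := f) (fun _ _ => rfl)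
      (fun i hi => (Function.update_of_ne hi n f).symm)]
    conv_lhs => rw [← Matrix.updateRow_eq_self (entryMatrix lam f) k]
    congr 1
    funext j
    have h := hc ((k : ℤ) - j) ((lam k : ℤ) - k + j)
    simp only [entryMatrix, Matrix.of_apply, Pi.add_apply, Pi.smul_apply, smul_eq_mul,
      Function.update_self, Function.update_of_ne hne.symm, hn, hl, hf, hk]
    push_cast
    convert h using 3 <;> ring_nf
  rw [h1, Matrix.det_updateRow_add_smul_self _ hne]

/-- An empty last row is the last unit vector, whatever its flag. -/
theorem entryMatrix_update_flag_of_empty {k : Fin r} (hk : (k : ℕ) + 1 = r) (h0 : lam k = 0)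
    (n : ℕ) : entryMatrix lam f = entryMatrix lam (Function.update f k n) := by
  ext1 i j
  rcases eq_or_ne i k with rfl | h
  · obtain ⟨d, hd⟩ := Nat.exists_eq_add_of_le (by omega : (j : ℕ) ≤ i)
    have h1 : (i : ℤ) - (j : ℤ) = d := by omega
    have h2 : (lam i : ℤ) - i + j = -d := by omega
    simp only [entryMatrix, Matrix.of_apply, h1, h2, entrySum_empty_row]
  · simp [entryMatrix, Function.update_of_ne h]

theorem det_entryMatrix_of_empty (h0 : ∀ i, lam i = 0) : (entryMatrix lam f).det = 1 := by
  have h : ∀ i j : Fin r, j ≤ i → entryMatrix lam f i j = if i = j then 1 else 0 := by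
    intro i j hij
    obtain ⟨d, hd⟩ := Nat.exists_eq_add_of_le (Fin.le_def.1 hij)
    have h1 : (i : ℤ) - (j : ℤ) = d := by omega
    have h2 : (lam i : ℤ) - i + j = -d := by
      rw [h0]
      omega
    simp only [entryMatrix, Matrix.of_apply, h1, h2, entrySum_empty_row]
    congr 1
    rw [Fin.ext_iff, eq_iff_iff]
    omega
  rw [Matrix.det_of_isUpperTriangular (fun i j hij => by
    rw [h i j (le_of_lt hij)]
    exact if_neg (ne_of_gt hij))]
  exact Finset.prod_eq_one fun i _ => by rw [h i i le_rfl, if_pos rfl]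

/-- With empty sets of possible entries and a nonempty diagram, the first row of the matrix
vanishes, because `genProd 0 (λ₁ - 1)` has degree at most `λ₁ - 1` in `u`. -/
theorem det_entryMatrix_of_flag_zero (hlam : Antitone lam) (hf : ∀ i, f i = 0) {i : Fin r}
    (hi : lam i ≠ 0) : (entryMatrix lam f).det = 0 := by
  have hr : 0 < r := i.pos
  have h1 : lam i ≤ lam ⟨0, hr⟩ := hlam (Fin.le_def.2 (Nat.zero_le _))
  refine Matrix.det_eq_zero_of_row_eq_zero ⟨0, hr⟩ fun j => ?_
  simp only [entryMatrix, Matrix.of_apply, hf]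
  exact entrySum_zero_left (by push_cast; omega) (by push_cast; omega) _

/-! ### Equality of the two recursions -/

theorem tableauSum_of_empty {R : Type*} [CommRing R] (bet : R) (wt : ℕ → ℕ → ℕ → R)
    (h0 : ∀ i, lam i = 0) : tableauSum bet wt lam f = 1 := by
  have : IsEmpty (Box lam) := ⟨fun c => absurd c.2.2 (by simp [h0 c.1])⟩
  have h : tableaux lam f = {isEmptyElim} := by
    ext T
    rw [mem_tableaux, Finset.mem_singleton]
    exact ⟨fun _ => Subsingleton.elim _ _, fun _ => ⟨isEmptyElim, isEmptyElim,
      isEmptyElim, isEmptyElim⟩⟩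
  simp [tableauSum, h]

theorem tableauSum_of_flag_zero {R : Type*} [CommRing R] (bet : R) (wt : ℕ → ℕ → ℕ → R)
    (hf : ∀ i, f i = 0) {i : Fin r} (hi : lam i ≠ 0) : tableauSum bet wt lam f = 0 := by
  refine Finset.sum_eq_zero fun T hT => ?_
  have hT := mem_tableaux.1 hT
  obtain ⟨v, hv⟩ := hT.nonempty ⟨i, ⟨0, Nat.pos_of_ne_zero hi⟩⟩
  have h := Finset.mem_Icc.1 (hT.flag _ hv)
  rw [hf] at h
  omega

theorem sum_update_lt {g : Fin r → ℕ} {k : Fin r} {n : ℕ} (h : n < g k) :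
    ∑ i, Function.update g k n i < ∑ i, g i := by
  refine Finset.sum_lt_sum (fun i _ => ?_) ⟨k, Finset.mem_univ k, by rwa [Function.update_self]⟩
  rcases eq_or_ne i k with rfl | hi
  · rw [Function.update_self]
    exact h.le
  · rw [Function.update_of_ne hi]

/-- The determinantal formula for weakly decreasing `lam` and weakly increasing `f`, both of which
may have zero parts. -/
theorem tableauSum_eq_det (lam f : Fin r → ℕ) (hlam : Antitone lam) (hf : Monotone f) :
    tableauSum beta serWeight lam f = (entryMatrix lam f).det := by
  induction hN : ∑ i, lam i + ∑ i, f i using Nat.strong_induction_on generalizing lam f with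
  | _ N ih =>
  by_cases h0 : ∀ i, lam i = 0
  · rw [tableauSum_of_empty _ _ h0, det_entryMatrix_of_empty h0]
  obtain ⟨i₀, hi₀⟩ := not_forall.1 h0
  by_cases hf0 : ∀ i, f i = 0
  · rw [tableauSum_of_flag_zero _ _ hf0 hi₀, det_entryMatrix_of_flag_zero hlam hf0 hi₀]
  obtain ⟨i₁, hi₁⟩ := not_forall.1 hf0
  -- `k` is the first row whose flag is the largest one.
  obtain ⟨k, hmax, habove⟩ : ∃ k, (∀ i, f i ≤ f k) ∧ ∀ i < k, f i < f k := by
    have : Nonempty (Fin r) := ⟨i₀⟩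
    obtain ⟨a, ha⟩ := Finite.exists_max f
    obtain ⟨k, hk, hmin⟩ := WellFounded.has_min (wellFounded_lt (α := Fin r))
      {i | f i = f a} ⟨a, rfl⟩
    refine ⟨k, fun i => (ha i).trans_eq hk.symm, fun i hi => ?_⟩
    exact lt_of_le_of_ne ((ha i).trans_eq hk.symm) fun h => hmin i (h.trans hk) hi
  obtain ⟨n, hn⟩ : ∃ n, f k = n + 1 := Nat.exists_eq_succ_of_ne_zero fun h => hi₁ (by
    have := hmax i₁
    omega)
  have hmono : Monotone (Function.update f k n) := by
    intro i j hij
    rcases eq_or_ne i k with hi | hi <;> rcases eq_or_ne j k with hj | hj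
    · rw [hi, hj]
    · have := hf hij
      rw [hi] at this ⊢
      rw [Function.update_self, Function.update_of_ne hj]
      omega
    · have := habove i (lt_of_le_of_ne (hij.trans_eq hj) hi)
      rw [hj, Function.update_self, Function.update_of_ne hi]
      omega
    · rw [Function.update_of_ne hi, Function.update_of_ne hj]
      exact hf hij
  have hsum : ∑ i, Function.update f k n i < ∑ i, f i := sum_update_lt (by omega)
  have ihf := ih _ (by omega) lam (Function.update f k n) hlam hmono rfl
  have hbox : lam k ≠ 0 → (∀ i : Fin r, (i : ℕ) = k + 1 → lam i < lam k) →
      tableauSum beta serWeight lam f = (entryMatrix lam f).det := by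
    intro hk hbelow
    obtain ⟨m, hm⟩ := Nat.exists_eq_succ_of_ne_zero hk
    have hanti : Antitone (Function.update lam k m) := by
      intro i j hij
      rcases eq_or_ne i k with hi | hi <;> rcases eq_or_ne j k with hj | hj
      · rw [hi, hj]
      · rw [hi] at hij ⊢
        have h1 : (k : ℕ) < j := lt_of_le_of_ne hij (fun h => hj (Fin.ext h.symm))
        have h2 := hbelow ⟨k + 1, by omega⟩ rfl
        have h3 : lam j ≤ lam ⟨k + 1, by omega⟩ := hlam (Fin.le_def.2 h1)
        rw [Function.update_self, Function.update_of_ne hj]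
        omega
      · have := hlam hij
        rw [hj] at this ⊢
        rw [Function.update_self, Function.update_of_ne hi]
        omega
      · rw [Function.update_of_ne hi, Function.update_of_ne hj]
        exact hlam hij
    have hsum' : ∑ i, Function.update lam k m i < ∑ i, lam i := sum_update_lt (by omega)
    have ihl := ih _ (by omega) (Function.update lam k m) f hanti hf rfl
    have h1 := tableauSum_last_box beta serWeight (c₀ := (⟨k, ⟨m, by omega⟩⟩ : Box lam)) hm.symm
      (fun i hi => Nat.lt_succ_iff.1 ((hbelow i hi).trans_eq hm))
      (fun i hi => habove i (Fin.lt_def.2 (by simp only at hi; omega))) hn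
    rw [h1, det_entryMatrix_last_box hm hn, ihf, ← ihl]
  by_cases hlast : (k : ℕ) + 1 = r
  · by_cases hk : lam k = 0
    · rw [tableauSum_update_flag _ _ hn (Or.inl hk), ihf,
        entryMatrix_update_flag_of_empty (f := f) hlast hk n]
    · exact hbox hk fun i hi => absurd i.2 (by omega)
  · have hk' : (k : ℕ) + 1 < r := by omega
    have hle : k ≤ ⟨k + 1, hk'⟩ := Fin.le_def.2 (Nat.le_succ _)
    have hfk : f ⟨k + 1, hk'⟩ = f k := le_antisymm (hmax _) (hf hle)
    rcases (hlam hle).eq_or_lt with h | h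
    · rw [tableauSum_update_flag _ _ hn (Or.inr ⟨_, rfl, h, hfk⟩), ihf,
        det_entryMatrix_update_flag hn rfl h hfk]
    · refine hbox (by omega) fun i hi => ?_
      rwa [show i = ⟨k + 1, hk'⟩ from Fin.ext hi]

theorem coe_xOplusB {i j v : ℕ} (h : i + 1 ≤ v) :
    ((xOplusB v (v + (j + 1) - (i + 1)) : Poly) : Ser) = serWeight i j v := by
  have h1 : (1 : ℤ) ≤ (v : ℤ) + j - i := by omega
  have h2 : ((v : ℤ) + j - i).toNat = v + (j + 1) - (i + 1) := by omega
  rw [serWeight, bInt, if_pos h1, h2]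
  simp [xOplusB, betaP, beta, x, b]

theorem IsTableau.entryCount_sub {T : Box lam → Finset ℕ} (hT : IsTableau lam f T) :
    entryCount T - ∑ i, lam i = ∑ c, ((T c).card - 1) := by
  have h : ∑ i, lam i = ∑ _c : Box lam, 1 := by
    simp
  rw [entryCount, h, ← Finset.sum_tsub_distrib]
  exact fun c _ => Finset.card_pos.2 (hT.nonempty c)

theorem coe_G (hlam : Antitone lam) : (G lam f : Ser) = tableauSum beta serWeight lam f := by
  rw [G, tableauSum, ← MvPolynomial.coeToMvPowerSeries.ringHom_apply, map_sum]
  refine Finset.sum_congr rfl fun T hT => ?_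
  have hT := mem_tableaux.1 hT
  simp only [weight, boxWeight, map_mul, map_pow, map_prod,
    MvPolynomial.coeToMvPowerSeries.ringHom_apply]
  rw [Finset.prod_mul_distrib, Finset.prod_pow_eq_pow_sum, hT.entryCount_sub]
  congr 1
  · simp [betaP, beta]
  · exact Finset.prod_congr rfl fun c _ => Finset.prod_congr rfl fun v hv =>
      coe_xOplusB (hT.row_le hlam c v hv)

end

end FlaggedGrothendieck

theorem theorem3p4 {r : ℕ} (lam f : Fin r → ℕ)
    (h : FlaggedGrothendieck.IsFlaggedPartition lam f) :
    (∀ i j : Fin r, Summable (FlaggedGrothendieck.entryTerm lam f i j)) ∧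
    (FlaggedGrothendieck.G lam f : FlaggedGrothendieck.Ser) =
      Matrix.det (Matrix.of fun i j : Fin r =>
        ∑' s : ℕ, FlaggedGrothendieck.entryTerm lam f i j s) := by
  refine ⟨fun i j => (FlaggedGrothendieck.eventuallyZero_calG _ _).summable _ _, ?_⟩
  rw [FlaggedGrothendieck.coe_G h.lam_anti,
    FlaggedGrothendieck.tableauSum_eq_det lam f h.lam_anti h.f_mono]
  rfl
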